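/- Let $D\subset\mathbb R^3$ be a bounded domain containing the origin, and let $V,f,\sigma\in L^\infty(\mathbb R^3;\mathbb R)$ have compact support in $D$. Let $\dot B$ be Gaussian white noise on $D$ over a probability space $(\Omega,\mathbb P)$: a linear isometry $\varphi\mapsto\langle\dot B,\varphi\rangle$ from $L^2(D)$ into $L^2(\Omega)$ with $\langle\dot B,\varphi\rangle\sim\mathcal N(0,\|\varphi\|_{L^2(D)}^2)$, extended complex-linearly to complex-valued $\varphi$. For $k>0$ put $\Phi_k(x,y)=\frac{e^{ik|x-y|}}{4\pi|x-y|}$, $(\mathcal R_k\varphi)(x)=\int\Phi_k(x,y)\varphi(y)\,dy$ and $\mathcal R_k(\sigma\dot B)(x)=\langle\dot B,\sigma\,\Phi_k(x,\cdot)\rangle$ (a measurable version of this random field being fixed). For $d\in\mathbb S^2$ let $u^i(x)=e^{ikx\cdot d}$, and let $u^{sc}(\cdot,k,d,\omega)$ be the scattered part of the mild solution of the random Schrödinger system with active incident wave ($\alpha=1$): for all wave numbers $k$ above some bound and all $d$, almost surely, $u^{sc}\in L^2_{-1/2-\epsilon}(\mathbb R^3)=\{u:(1+|x|^2)^{-1/4-\epsilon/2}u\in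 L^2\}$ for every $\epsilon>0$, and $$(I-\mathcal R_kV)u^{sc}=\mathcal R_k(Vu^i)-\mathcal R_kf-\mathcal R_k(\sigma\dot B)\quad\text{a.e. in }\mathbb R^3 .$$ Its far-field pattern is $u^\infty(\hat x,k,d,\omega)=\frac1{4\pi}\int_De^{-ik\hat x\cdot y}(I-V\mathcal R_k)^{-1}(Vu^i-f-\sigma\dot B)\,dy$, that is, $$u^\infty(\hat x,k,d,\omega)=\frac1{4\pi}\Big[\int_De^{-ik\hat x\cdot y}\big(Vu^i-f+Vu^{sc}\big)\,dy-\langle\dot B,\sigma e^{-ik\hat x\cdot(\cdot)}\rangle(\omega)\Big],\qquad \hat x\in\mathbb S^2$$ (again with a fixed measurable version of the last term). Let $\mathcal M_2(\omega)$ be the family of all values $u^\infty(\hat x,k,d,\omega)$, $\hat x,d\in\mathbb S^2$, $k>0$; only the values for large $k$ matter. Write $\widehat V(p)=(2\pi)^{-3/2}\int e^{-ip\cdot x}V(x)\,dx$. Then a single realization of $\mathcal M_2$ uniquely determines $V$, without knowledge of $\sigma$ and $f$: there is one map $\mathscr R$, independent of $D,V,f,\sigma$ and of the noise, such that for all such systems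 $\mathscr R(\mathcal M_2(\omega))=V$ almost everywhere in $\mathbb R^3$, for almost every $\omega$. Moreover: 1. For every $p\in\mathbb R^3$ there are directions $\hat x,d_1,d_2\in\mathbb S^2$, depending on $k$, with $k(\hat x-d_1)=p$ for all large $k$ and $|k(\hat x-d_2)|\to\infty$ as $k\to\infty$. For every such choice, $$\widehat V(p)=\sqrt{\tfrac2\pi}\,\lim_{k\to\infty}\big(u^\infty(\hat x,k,d_1,\omega)-u^\infty(\hat x,k,d_2,\omega)\big).$$ This limit holds almost surely along each sequence of wave numbers tending to infinity, and as $k\to\infty$ through the reals for every sample $\omega$ at which the equation for $u^{sc}$ holds for all large $k$ and all $d$. 2. There are constants $C,K$ such that for all $k>K$, all $\hat x,d_1,d_2\in\mathbb S^2$, and every $\omega$ at which the equation for $u^{sc}$ holds for $(k,d_1)$ and $(k,d_2)$, $$\Big|u^\infty(\hat x,k,d_1,\omega)-u^\infty(\hat x,k,d_2,\omega)-\sqrt{\tfrac\pi2}\big(\widehat V(k(\hat x-d_1))-\widehat V(k(\hat x-d_2))\big)\Big|\le\frac Ck .$$ -/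

import Mathlib

open MeasureTheory ProbabilityTheory Filter Topology
open scoped ENNReal NNReal

noncomputable section

namespace RandomSchrodinger

/-- Three-dimensional Euclidean space. -/
abbrev E3 : Type := EuclideanSpace ℝ (Fin 3)

/-- The unit sphere of directions. -/
abbrev S2 : Type := Metric.sphere (0 : E3) 1

/-- A bounded domain (open connected set) containing the origin. -/
structure IsBoundedDomain (D : Set E3) : Prop where
  isOpen : IsOpen D
  isPreconnected : IsPreconnected D
  isBounded : Bornology.IsBounded D
  zero_mem : (0 : E3) ∈ D

/-- A real-valued essentially bounded function, compactly supported in `D`. -/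
structure IsCoefficient (D : Set E3) (g : E3 → ℝ) : Prop where
  memLp_top : MemLp g ∞ volume
  hasCompactSupport : HasCompactSupport g
  tsupport_subset : tsupport g ⊆ D

/-- The incident plane wave `exp (i k x · d)`. -/
def planeWave (k : ℝ) (d : S2) (x : E3) : ℂ :=
  Complex.exp (Complex.I * (k * inner ℝ x (d : E3) : ℝ))

/-- The outgoing fundamental solution `exp (i k |x - y|) / (4 π |x - y|)` of `-Δ - k²`. -/
def fundamentalSolution (k : ℝ) (x y : E3) : ℂ :=
  Complex.exp (Complex.I * (k * ‖x - y‖ : ℝ)) / (4 * Real.pi * ‖x - y‖ : ℝ)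

/-- The resolvent operator `(R_k φ)(x) = ∫ Φ_k(x, y) φ(y) dy`. -/
def resolvent (k : ℝ) (φ : E3 → ℂ) (x : E3) : ℂ :=
  ∫ y, fundamentalSolution k x y * φ y

/-- Membership in the weighted space `L²_s(ℝ³)`, with weight `(1 + |x|²)^(s/2)`. -/
def MemWeightedL2 (s : ℝ) (u : E3 → ℂ) : Prop :=
  MemLp (fun x => ((Real.sqrt (1 + ‖x‖ ^ 2) ^ s : ℝ) : ℂ) * u x) 2 volume

/-- The unitary Fourier transform `(2π)^(-3/2) ∫ exp (-i p · x) g(x) dx`. -/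
def fourierHat (g : E3 → ℝ) (p : E3) : ℂ :=
  (((2 * Real.pi) ^ (-(3 / 2) : ℝ) : ℝ) : ℂ) *
    ∫ x, Complex.exp (-Complex.I * (inner ℝ p x : ℝ)) * (g x : ℂ)

section Noise

variable {Ω : Type*} [MeasurableSpace Ω] {P : Measure Ω} {D : Set E3}

/-- Gaussian white noise on `D`, as a linear isometric map `φ ↦ ⟨Ḃ, φ⟩` from `L²(D)` to the
square-integrable random variables (so that `𝔼 ⟨Ḃ, φ⟩⟨Ḃ, ψ⟩ = ∫_D φ ψ`), such that
`⟨Ḃ, φ⟩` has law `N(0, ‖φ‖²)`. -/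
def IsWhiteNoise (W : Lp ℝ 2 (volume.restrict D) →ₗᵢ[ℝ] Lp ℝ 2 P) : Prop :=
  ∀ φ : Lp ℝ 2 (volume.restrict D), P.map (W φ : Ω → ℝ) = gaussianReal 0 (‖φ‖₊ ^ 2)

open Classical in
/-- The complex-linear extension `⟨Ḃ, φ⟩ = ⟨Ḃ, Re φ⟩ + i ⟨Ḃ, Im φ⟩`, for `φ ∈ L²(D; ℂ)`
(and `0` for all other `φ`). As an element of `L²(Ω)` it is defined up to a null set. -/
def pairing (W : Lp ℝ 2 (volume.restrict D) →ₗᵢ[ℝ] Lp ℝ 2 P) (φ : E3 → ℂ) (ω : Ω) : ℂ :=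
  if h : MemLp φ 2 (volume.restrict D) then
    ((W (h.re.toLp _) : Ω → ℝ) ω : ℂ) + Complex.I * ((W (h.im.toLp _) : Ω → ℝ) ω : ℂ)
  else 0

/-- `G k x ω` is a measurable version of the random field
`R_k(σ Ḃ)(x) = ⟨Ḃ, σ Φ_k(x, ·)⟩`. -/
structure IsNoisePotential (W : Lp ℝ 2 (volume.restrict D) →ₗᵢ[ℝ] Lp ℝ 2 P) (σ : E3 → ℝ)
    (G : ℝ → E3 → Ω → ℂ) : Prop where
  measurable : ∀ k > 0, Measurable (fun z : E3 × Ω => G k z.1 z.2)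
  version : ∀ k > 0, ∀ x : E3,
    G k x =ᵐ[P] pairing W (fun y => (σ y : ℂ) * fundamentalSolution k x y)

/-- `N k xhat ω` is a measurable version of the random field
`⟨Ḃ, σ exp (-i k xhat · y)⟩`, that is of `∫_D exp (-i k xhat · y) σ(y) Ḃ_y dy`. -/
structure IsNoiseFarField (W : Lp ℝ 2 (volume.restrict D) →ₗᵢ[ℝ] Lp ℝ 2 P) (σ : E3 → ℝ)
    (N : ℝ → S2 → Ω → ℂ) : Prop where
  measurable : ∀ k > 0, Measurable (fun z : S2 × Ω => N k z.1 z.2)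
  version : ∀ k > 0, ∀ xhat : S2,
    N k xhat =ᵐ[P] pairing W (fun y => (σ y : ℂ) * planeWave (-k) xhat y)

end Noise

/-- For one sample: `u` is the scattered wave for the wave number `k` and the incident direction
`d` when `R_k(σ Ḃ)` takes the value `g`. That is, `u` lies in `L²_{-1/2-ε}` for every `ε > 0`
and solves `(I - R_k V) u = R_k V uⁱ - R_k f - R_k(σ Ḃ)`. -/
structure IsScatteredWave (V f : E3 → ℝ) (g : E3 → ℂ) (k : ℝ) (d : S2) (u : E3 → ℂ) : Prop where
  memWeightedL2 : ∀ ε > 0, MemWeightedL2 (-(1 / 2) - ε) u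
  lippmannSchwinger : ∀ᵐ x ∂(volume : Measure E3),
    u x - resolvent k (fun y => (V y : ℂ) * u y) x =
      resolvent k (fun y => (V y : ℂ) * planeWave k d y) x
        - resolvent k (fun y => (f y : ℂ)) x - g x

/-- The scattered part of the mild solution (incident wave switched on), for all wave numbers
`k > κ` and all incident directions: a stochastic process whose paths are almost surely scattered
waves. -/
structure IsMildSolution {Ω : Type*} [MeasurableSpace Ω] (P : Measure Ω) (V f : E3 → ℝ)
    (G : ℝ → E3 → Ω → ℂ) (κ : ℝ) (usc : ℝ → S2 → E3 → Ω → ℂ) : Prop where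
  aemeasurable : ∀ k > κ, ∀ (d : S2) (x : E3), AEMeasurable (usc k d x) P
  isScatteredWave : ∀ k > κ, ∀ d : S2, ∀ᵐ ω ∂P,
    IsScatteredWave V f (fun x => G k x ω) k d (fun x => usc k d x ω)

/-- The far-field pattern
`u^∞ = (4π)⁻¹ ∫_D exp (-i k xhat · y) (I - V R_k)⁻¹ (V uⁱ - f - σ Ḃ) dy` for one sample. As
`(I - V R_k)⁻¹ = I + V (I - R_k V)⁻¹ R_k`, the density is `V uⁱ - f - σ Ḃ + V u`, with `u` the
scattered wave. The argument `n` is the value of `∫_D exp (-i k xhat · y) σ(y) Ḃ_y dy`. -/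
def farField (D : Set E3) (V f : E3 → ℝ) (k : ℝ) (xhat d : S2) (u : E3 → ℂ) (n : ℂ) : ℂ :=
  1 / (4 * Real.pi : ℝ) *
    ((∫ y in D, planeWave (-k) xhat y *
        ((V y : ℂ) * planeWave k d y - (f y : ℂ) + (V y : ℂ) * u y)) - n)

/-- The active far-field data of the sample `ω`, as a function of the observation direction, the
wave number and the incident direction. -/
def activeData {Ω : Type*} (D : Set E3) (V f : E3 → ℝ) (N : ℝ → S2 → Ω → ℂ)
    (usc : ℝ → S2 → E3 → Ω → ℂ) (ω : Ω) (xhat : S2) (k : ℝ) (d : S2) : ℂ :=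
  farField D V f k xhat d (fun x => usc k d x ω) (N k xhat ω)

/-- Wave numbers `k → ∞` and directions with `k (xhat - d₁) = p` and `|k (xhat - d₂)| → ∞`. -/
structure IsDirectionChoice {ι : Type*} (l : Filter ι) (p : E3) (k : ι → ℝ)
    (xhat d₁ d₂ : ι → S2) : Prop where
  tendsto_waveNumber : Tendsto k l atTop
  eq_frequency : ∀ᶠ i in l, k i • ((xhat i : E3) - (d₁ i : E3)) = p
  tendsto_norm : Tendsto (fun i => ‖k i • ((xhat i : E3) - (d₂ i : E3))‖) l atTop

end RandomSchrodinger

end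

open RandomSchrodinger

/-! For two incident directions and the same sample, source and noise enter the Lippmann–Schwinger
equation and the far field in the same way, so they drop out of differences. The difference `w` of
the two scattered waves solves `w = R_k V (u₁ⁱ - u₂ⁱ + w)` on `D`, a deterministic equation.

The analytic input is that `R_k` is `O(1/k)` on `L²(D)` (`eLpNorm_resolvent_le`). On `D` it is
convolution with a kernel cut off at the diameter scale, so by Plancherel it suffices to bound the
Fourier transform of that kernel. Integrating over planes orthogonal to the frequency leaves exact
derivatives, and the bound `2R/k` appears (`norm_fourier_cutoffKernel_le`).

For large `k` the term in `w` on the right is absorbed, so `w = O(1/k)` in `L²(D)`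
(`exists_eLpNorm_sub_le`). The far-field difference is then its Born approximation up to `O(1/k)`
(`exists_norm_farField_sub_le`). With `k(xhat - d₁) = p` fixed and `|k(xhat - d₂)| → ∞`, one Born
term is the transform of `V` at `p` and the other vanishes by Riemann–Lebesgue.

Almost surely this works at countably many dense frequencies at once. The transform is continuous
and injective, so these limits determine `V`. -/

noncomputable section

/-! ### Plancherel's theorem for the Fourier integral. -/

section Plancherel

open FourierTransform SchwartzMap
open scoped ContDiff

variable {E : Type*} [NormedAddCommGroup E] [InnerProductSpace ℝ E] [FiniteDimensional ℝ E]
  [MeasurableSpace E] [BorelSpace E]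

theorem integral_fourier_mul_eq {f g : E → ℂ} (hf : Integrable f) (hg : Integrable g) :
    ∫ x, 𝓕 f x * g x = ∫ x, f x * 𝓕 g x := by
  have h := VectorFourier.integral_fourierIntegral_smul_eq_flip (μ := (volume : Measure E))
    (ν := (volume : Measure E)) (L := innerₗ E) Real.continuous_fourierChar
    (by exact continuous_inner) hf hg
  simp only [flip_innerₗ] at h
  exact h

theorem continuous_fourier_of_integrable {f : E → ℂ} (hf : Integrable f) : Continuous (𝓕 f) :=
  VectorFourier.fourierIntegral_continuous Real.continuous_fourierChar
    (by exact continuous_inner) hf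

/-- The `L²` Fourier transform is given by the Fourier integral on `L¹ ∩ L²`. -/
theorem fourier_toLp_ae_eq {f : E → ℂ} (hf : Integrable f) (hf2 : MemLp f 2) :
    (𝓕 (hf2.toLp f : Lp (α := E) ℂ 2) : Lp (α := E) ℂ 2) =ᵐ[volume] 𝓕 f := by
  have h := Lp.fourier_toTemperedDistribution_eq (hf2.toLp f)
  set F : Lp (α := E) ℂ 2 := 𝓕 (hf2.toLp f : Lp (α := E) ℂ 2)
  -- Both sides are locally integrable, so testing against smooth compactly supported functions
  -- suffices. Such a test function is Schwartz, and the distributional definition moves the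
  -- transform onto it.
  refine ae_eq_of_integral_contDiff_smul_eq
    ((Lp.memLp _).locallyIntegrable (by norm_num))
    (continuous_fourier_of_integrable hf).locallyIntegrable ?_
  intro g hg hgc
  have hG : HasCompactSupport (fun x => (g x : ℂ)) := hgc.comp_left (g := Complex.ofReal) rfl
  have hG' : ContDiff ℝ (((⊤ : ℕ∞)) : WithTop ℕ∞) (fun x => (g x : ℂ)) := Complex.ofRealCLM.contDiff.comp hg
  let G : 𝓢(E, ℂ) := hG.toSchwartzMap hG'
  have h1 := congrArg (fun T => T G) h
  simp only [TemperedDistribution.fourier_apply, Lp.toTemperedDistribution_apply] at h1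
  have hGx : ∀ x, G x = (g x : ℂ) := fun x => rfl
  calc ∫ x, g x • F x
      = ∫ x, G x • F x := by
        simp only [hGx, Complex.real_smul, smul_eq_mul]
    _ = ∫ x, (𝓕 G) x • (hf2.toLp f) x := h1.symm
    _ = ∫ x, f x * 𝓕 (G : E → ℂ) x := by
        refine integral_congr_ae ?_
        filter_upwards [MemLp.coeFn_toLp hf2] with x hx
        rw [hx, SchwartzMap.fourier_coe, smul_eq_mul, mul_comm]
    _ = ∫ x, 𝓕 f x * G x := (integral_fourier_mul_eq hf G.integrable).symm
    _ = ∫ x, g x • 𝓕 f x := by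
        simp only [hGx, Complex.real_smul, mul_comm]

/-- **Plancherel's theorem** on `L¹ ∩ L²`. -/
theorem eLpNorm_fourier_eq {f : E → ℂ} (hf : Integrable f) (hf2 : MemLp f 2) :
    eLpNorm (𝓕 f) 2 volume = eLpNorm f 2 volume := by
  rw [← eLpNorm_congr_ae (fourier_toLp_ae_eq hf hf2), ← eLpNorm_congr_ae hf2.coeFn_toLp]
  have := Lp.norm_fourier_eq (hf2.toLp f)
  rw [Lp.norm_def, Lp.norm_def] at this
  exact (ENNReal.toReal_eq_toReal_iff' (Lp.eLpNorm_ne_top _) (Lp.eLpNorm_ne_top _)).1 this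

theorem ae_eq_zero_of_fourier_eq_zero {f : E → ℂ} (hf : Integrable f) (hf2 : MemLp f 2)
    (h : ∀ p, 𝓕 f p = 0) : f =ᵐ[volume] 0 := by
  rw [← eLpNorm_eq_zero_iff hf2.1 two_ne_zero, ← eLpNorm_fourier_eq hf hf2,
    show 𝓕 f = 0 from funext h, eLpNorm_zero]

end Plancherel

/-! ### Convolution as a Fourier multiplier. -/

section Convolution

open FourierTransform Convolution

variable {E : Type*} [NormedAddCommGroup E] [InnerProductSpace ℝ E] [FiniteDimensional ℝ E]
  [MeasurableSpace E] [BorelSpace E]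

/-- Cauchy–Schwarz, since `t ↦ x - t` preserves the measure. Boundedness puts an integrable
convolution in `L²`, where Plancherel applies. -/
theorem norm_convolution_mul_le {K φ : E → ℂ} (hK2 : MemLp K 2) (hφ2 : MemLp φ 2) (x : E) :
    ‖(K ⋆[ContinuousLinearMap.mul ℂ ℂ] φ) x‖ ≤
      (eLpNorm φ 2 volume * eLpNorm K 2 volume).toReal := by
  have hmp : MeasurePreserving (fun t : E => x - t) := Measure.measurePreserving_sub_left volume x
  have hsub : MemLp (fun t => φ (x - t)) 2 := hφ2.comp_measurePreserving hmp
  have hn : eLpNorm (fun t => φ (x - t)) 2 volume = eLpNorm φ 2 volume :=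
    eLpNorm_comp_measurePreserving hφ2.1 hmp
  have h1 : eLpNorm ((fun t => φ (x - t)) • K) 1 volume ≤
      eLpNorm φ 2 volume * eLpNorm K 2 volume := by
    rw [← hn]
    exact eLpNorm_smul_le_mul_eLpNorm hK2.1 hsub.1
  have hfin : eLpNorm φ 2 volume * eLpNorm K 2 volume ≠ ∞ :=
    ENNReal.mul_ne_top hφ2.2.ne hK2.2.ne
  rw [convolution_def]
  simp only [ContinuousLinearMap.mul_apply']
  refine (norm_integral_le_integral_norm _).trans ?_
  rw [integral_norm_eq_lintegral_enorm (f := fun t => K t * φ (x - t)) (hK2.1.mul hsub.1)]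
  refine ENNReal.toReal_mono hfin (le_trans (le_of_eq ?_) h1)
  rw [eLpNorm_one_eq_lintegral_enorm]
  simp [mul_comm]

/-- An integrable function with bounded Fourier transform is a Fourier multiplier. -/
theorem eLpNorm_convolution_le_of_norm_fourier_le {K φ : E → ℂ} {C : ℝ}
    (hK : Integrable K) (hK2 : MemLp K 2) (hKC : ∀ ξ, ‖𝓕 K ξ‖ ≤ C)
    (hφ : Integrable φ) (hφ2 : MemLp φ 2) :
    eLpNorm (K ⋆[ContinuousLinearMap.mul ℂ ℂ] φ) 2 volume ≤
      ENNReal.ofReal C * eLpNorm φ 2 volume := by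
  have hint : Integrable (K ⋆[ContinuousLinearMap.mul ℂ ℂ] φ) :=
    hK.integrable_convolution (ContinuousLinearMap.mul ℂ ℂ) hφ
  have hL2 : MemLp (K ⋆[ContinuousLinearMap.mul ℂ ℂ] φ) 2 := by
    rw [memLp_two_iff_integrable_sq_norm hint.1]
    refine (hint.norm.const_mul (eLpNorm φ 2 volume * eLpNorm K 2 volume).toReal).mono'
      (hint.1.norm.pow 2) (.of_forall fun x => ?_)
    rw [Real.norm_of_nonneg (by positivity), sq]
    exact mul_le_mul_of_nonneg_right (norm_convolution_mul_le hK2 hφ2 x) (norm_nonneg _)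
  rw [← eLpNorm_fourier_eq hint hL2, ← eLpNorm_fourier_eq hφ hφ2]
  refine eLpNorm_le_mul_eLpNorm_of_ae_le_mul (.of_forall fun ξ => ?_) 2
  rw [Real.fourier_mul_convolution_eq hK hφ, norm_mul]
  exact mul_le_mul_of_nonneg_right (hKC ξ) (norm_nonneg _)

end Convolution

/-! ### The cut-off kernel and its Fourier transform. -/

namespace RandomSchrodinger

/-- The radial profile of the outgoing fundamental solution, cut off at the radius `R`. -/
def cutoffProfile (k R r : ℝ) : ℂ :=
  if r ≤ R then Complex.exp (Complex.I * (k * r : ℝ)) / (4 * Real.pi * r : ℝ) else 0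

/-- The convolution kernel of the resolvent, cut off at the radius `R`. -/
def cutoffKernel (k R : ℝ) (z : E3) : ℂ := cutoffProfile k R ‖z‖

theorem measurable_cutoffProfile (k R : ℝ) : Measurable (cutoffProfile k R) := by
  unfold cutoffProfile
  exact Measurable.ite measurableSet_Iic (by fun_prop) measurable_const

theorem measurable_cutoffKernel (k R : ℝ) : Measurable (cutoffKernel k R) :=
  (measurable_cutoffProfile k R).comp measurable_norm

theorem norm_exp_I_mul_ofReal (t : ℝ) : ‖Complex.exp (Complex.I * (t : ℝ))‖ = 1 := by
  rw [mul_comm, Complex.norm_exp_ofReal_mul_I]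

theorem norm_cutoffProfile (k R : ℝ) {r : ℝ} (hr : 0 < r) :
    ‖cutoffProfile k R r‖ = if r ≤ R then (4 * Real.pi * r)⁻¹ else 0 := by
  unfold cutoffProfile
  split_ifs
  · rw [norm_div, norm_exp_I_mul_ofReal, Complex.norm_real, Real.norm_of_nonneg (by positivity),
      one_div]
  · simp

theorem integrable_cutoffKernel (k R : ℝ) : Integrable (cutoffKernel k R) := by
  refine (integrable_fun_norm_addHaar (volume : Measure E3) (f := cutoffProfile k R)).2 ?_
  have hfin : Module.finrank ℝ E3 - 1 = 2 := by simp
  rw [hfin]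
  have hb : IntegrableOn ((Set.Iic R).indicator fun _ => R / (4 * Real.pi)) (Set.Ioi 0) := by
    rw [IntegrableOn, integrable_indicator_iff measurableSet_Iic, IntegrableOn,
      Measure.restrict_restrict measurableSet_Iic, Set.Iic_inter_Ioi]
    exact integrable_const _
  refine hb.mono' ?_ ?_
  · exact ((measurable_id.pow_const 2).smul (measurable_cutoffProfile k R)).aestronglyMeasurable
  · refine (ae_restrict_iff' measurableSet_Ioi).2 (.of_forall fun r hr => ?_)
    have hr : 0 < r := hr
    rw [norm_smul, norm_cutoffProfile k R hr, Real.norm_of_nonneg (by positivity)]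
    by_cases h : r ≤ R
    · rw [if_pos h, Set.indicator_of_mem (by exact h)]
      field_simp
      exact h
    · rw [if_neg h, Set.indicator_of_notMem (by exact h), mul_zero]

/-- In polar coordinates the Jacobian `r²` cancels the square of `1/(4πr)`, which leaves a constant
on `(0, R]`. -/
theorem memLp_two_cutoffKernel (k R : ℝ) : MemLp (cutoffKernel k R) 2 := by
  rw [memLp_two_iff_integrable_sq_norm (measurable_cutoffKernel k R).aestronglyMeasurable]
  refine (integrable_fun_norm_addHaar (volume : Measure E3)
    (f := fun r => ‖cutoffProfile k R r‖ ^ 2)).2 ?_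
  have hfin : Module.finrank ℝ E3 - 1 = 2 := by simp
  rw [hfin]
  have hb : IntegrableOn ((Set.Iic R).indicator fun _ => (4 * Real.pi)⁻¹ ^ 2) (Set.Ioi 0) := by
    rw [IntegrableOn, integrable_indicator_iff measurableSet_Iic, IntegrableOn,
      Measure.restrict_restrict measurableSet_Iic, Set.Iic_inter_Ioi]
    exact integrable_const _
  refine hb.mono' ?_ ?_
  · exact ((measurable_id.pow_const 2).smul
      ((measurable_cutoffProfile k R).norm.pow_const 2)).aestronglyMeasurable
  · refine (ae_restrict_iff' measurableSet_Ioi).2 (.of_forall fun r hr => ?_)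
    have hr : 0 < r := hr
    rw [norm_smul, norm_cutoffProfile k R hr, Real.norm_of_nonneg (by positivity),
      Real.norm_of_nonneg (by positivity)]
    by_cases h : r ≤ R
    · rw [if_pos h, Set.indicator_of_mem (by exact h)]
      apply le_of_eq
      field_simp
    · rw [if_neg h, Set.indicator_of_notMem (by exact h)]
      simp

/-- The planar Jacobian makes the integrand exact: with `s = √(t² + ρ²)`, the derivative of
`exp(iks)/(4πik)` in `ρ` is `ρ exp(iks)/(4πs)`. Only two boundary values remain, and they carry the
factor `1/k`. The condition `t ≠ 0` keeps `s` smooth at `ρ = 0`. -/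
theorem norm_integral_slice_le {k R t : ℝ} (hk : 0 < k) (ht : t ≠ 0) :
    ‖∫ η : EuclideanSpace ℝ (Fin 2), cutoffProfile k R (Real.sqrt (t ^ 2 + ‖η‖ ^ 2))‖ ≤
      (Set.Icc (-R) R).indicator (fun _ => 1 / k) t := by
  have hrad := integral_fun_norm_addHaar (volume : Measure (EuclideanSpace ℝ (Fin 2)))
    (fun ρ => cutoffProfile k R (Real.sqrt (t ^ 2 + ρ ^ 2)))
  have hvol : (volume : Measure (EuclideanSpace ℝ (Fin 2))).real (Metric.ball 0 1) = Real.pi := by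
    rw [Measure.real, EuclideanSpace.volume_ball_fin_two]
    simp [Real.pi_nonneg]
  rw [hrad, hvol]
  simp only [finrank_euclideanSpace, Fintype.card_fin, Nat.add_one_sub_one, pow_one]
  by_cases htR : |t| ≤ R
  swap
  · have h0 : ∀ ρ : ℝ, cutoffProfile k R (Real.sqrt (t ^ 2 + ρ ^ 2)) = 0 := fun ρ => by
      refine if_neg fun h => htR (le_trans ?_ h)
      exact Real.abs_le_sqrt (by nlinarith [sq_nonneg ρ])
    rw [Set.indicator_of_notMem (by rwa [Set.mem_Icc, ← abs_le])]
    simp [h0]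
  have hR : 0 ≤ R := (abs_nonneg t).trans htR
  have htR2 : t ^ 2 ≤ R ^ 2 := sq_le_sq.2 (htR.trans (le_abs_self R))
  have hpos : ∀ ρ : ℝ, 0 < t ^ 2 + ρ ^ 2 := fun ρ => by positivity
  have hsq : ∀ ρ : ℝ, 0 < Real.sqrt (t ^ 2 + ρ ^ 2) := fun ρ => Real.sqrt_pos.2 (hpos ρ)
  -- The plane at height `t` meets the ball of radius `R` in a disc of radius `b`.
  set b := Real.sqrt (R ^ 2 - t ^ 2) with hb
  have hmem : ∀ ρ : ℝ, 0 < ρ → (Real.sqrt (t ^ 2 + ρ ^ 2) ≤ R ↔ ρ ≤ b) := fun ρ hρ => by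
    rw [Real.sqrt_le_left hR, hb, Real.le_sqrt hρ.le (by linarith)]
    constructor <;> intro h <;> linarith
  let F : ℝ → ℂ := fun ρ =>
    Complex.exp (Complex.I * (k * Real.sqrt (t ^ 2 + ρ ^ 2) : ℝ)) / (4 * Real.pi * (Complex.I * k))
  let F' : ℝ → ℂ := fun ρ => (ρ : ℂ) * (Complex.exp (Complex.I * (k * Real.sqrt (t ^ 2 + ρ ^ 2) : ℝ))
    / (4 * Real.pi * Real.sqrt (t ^ 2 + ρ ^ 2) : ℝ))
  have hkC : (k : ℂ) ≠ 0 := by exact_mod_cast hk.ne'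
  have hπ : (Real.pi : ℂ) ≠ 0 := by exact_mod_cast Real.pi_ne_zero
  have hder : ∀ ρ, HasDerivAt F (F' ρ) ρ := fun ρ => by
    have h1 : HasDerivAt (fun ρ : ℝ => t ^ 2 + ρ ^ 2) (2 * ρ) ρ := by
      simpa using (hasDerivAt_pow 2 ρ).const_add (t ^ 2)
    have h2 := (h1.sqrt (hpos ρ).ne').const_mul k
    have h3 := ((h2.ofReal_comp.const_mul Complex.I).cexp).div_const
      (4 * (Real.pi : ℂ) * (Complex.I * k))
    refine h3.congr_deriv ?_
    have hs : ((Real.sqrt (t ^ 2 + ρ ^ 2) : ℝ) : ℂ) ≠ 0 := by exact_mod_cast (hsq ρ).ne'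
    simp only [F']
    push_cast
    field_simp
  have hF'c : Continuous F' := by
    have : ∀ ρ : ℝ, ((4 * Real.pi * Real.sqrt (t ^ 2 + ρ ^ 2) : ℝ) : ℂ) ≠ 0 := fun ρ => by
      exact_mod_cast (mul_pos (by positivity) (hsq ρ)).ne'
    fun_prop (disch := assumption)
  have hint : ∫ ρ in Set.Ioi (0 : ℝ), ρ • cutoffProfile k R (Real.sqrt (t ^ 2 + ρ ^ 2)) =
      F b - F 0 := by
    rw [← intervalIntegral.integral_eq_sub_of_hasDerivAt (fun ρ _ => hder ρ)
      (hF'c.intervalIntegrable _ _), intervalIntegral.integral_of_le (Real.sqrt_nonneg _),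
      ← Set.Ioi_inter_Iic, ← setIntegral_indicator measurableSet_Iic]
    refine setIntegral_congr_fun measurableSet_Ioi fun ρ hρ => ?_
    by_cases h : ρ ≤ b
    · rw [Set.indicator_of_mem (by exact h)]
      simp only [cutoffProfile, if_pos ((hmem ρ hρ).2 h), F', Complex.real_smul]
    · rw [Set.indicator_of_notMem (by exact h)]
      simp only [cutoffProfile, if_neg (mt (hmem ρ hρ).1 h), smul_zero]
  have hFn : ∀ ρ, ‖F ρ‖ = 1 / (4 * Real.pi * k) := fun ρ => by
    simp only [F, norm_div, norm_exp_I_mul_ofReal, norm_mul, Complex.norm_I, Complex.norm_real,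
      Real.norm_of_nonneg hk.le, Real.norm_of_nonneg Real.pi_nonneg, one_mul]
    norm_num
  rw [hint, Set.indicator_of_mem (by rwa [Set.mem_Icc, ← abs_le]), nsmul_eq_mul, norm_mul,
    norm_smul, Real.norm_of_nonneg Real.pi_nonneg]
  -- Each boundary value has modulus `1/(4πk)`, and the angular factor is `2π`.
  have hd := norm_sub_le (F b) (F 0)
  rw [hFn, hFn] at hd
  calc ‖((2 : ℕ) : ℂ)‖ * (Real.pi * ‖F b - F 0‖)
      ≤ 2 * (Real.pi * (1 / (4 * Real.pi * k) + 1 / (4 * Real.pi * k))) := by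
        have : ‖((2 : ℕ) : ℂ)‖ = 2 := by norm_num
        rw [this]
        gcongr
    _ = 1 / k := by
        field_simp
        norm_num

open FourierTransform

/-- Any isometry sends `(‖ξ‖, 0)` to a vector as long as `ξ`, and a reflection exchanges the two. In
these coordinates the phase of the Fourier integral is constant on the planes orthogonal to `ξ`. -/
theorem exists_linearIsometryEquiv_prod (ξ : E3) :
    ∃ A : WithLp 2 (ℝ × EuclideanSpace ℝ (Fin 2)) ≃ₗᵢ[ℝ] E3,
      A (WithLp.toLp 2 (‖ξ‖, 0)) = ξ := by
  have hdim : Module.finrank ℝ (WithLp 2 (ℝ × EuclideanSpace ℝ (Fin 2))) = 3 := by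
    rw [(WithLp.linearEquiv 2 ℝ (ℝ × EuclideanSpace ℝ (Fin 2))).finrank_eq]
    simp
  let B : WithLp 2 (ℝ × EuclideanSpace ℝ (Fin 2)) ≃ₗᵢ[ℝ] E3 :=
    ((stdOrthonormalBasis ℝ _).reindex (finCongr hdim)).repr
  set v := B (WithLp.toLp 2 (‖ξ‖, 0))
  have hv : ‖v‖ = ‖ξ‖ := by
    rw [LinearIsometryEquiv.norm_map, WithLp.prod_norm_eq_of_L2]
    simp
  exact ⟨B.trans (Submodule.reflection (Submodule.span ℝ {v - ξ})ᗮ), Submodule.reflection_sub hv⟩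

/-- The Fourier transform of the cut-off kernel is `O(1 / k)`, uniformly in the frequency. -/
theorem norm_fourier_cutoffKernel_le {k R : ℝ} (hk : 0 < k) (hR : 0 ≤ R) (ξ : E3) :
    ‖𝓕 (cutoffKernel k R) ξ‖ ≤ 2 * R / k := by
  obtain ⟨A, hA⟩ := exists_linearIsometryEquiv_prod ξ
  have hmp := WithLp.volume_preserving_toLp ℝ (EuclideanSpace ℝ (Fin 2))
  have hme : MeasurableEmbedding
      (WithLp.toLp 2 : ℝ × EuclideanSpace ℝ (Fin 2) → WithLp 2 (ℝ × EuclideanSpace ℝ (Fin 2))) :=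
    (MeasurableEquiv.toLp 2 (ℝ × EuclideanSpace ℝ (Fin 2))).measurableEmbedding
  have hnorm : ∀ p : ℝ × EuclideanSpace ℝ (Fin 2),
      ‖A (WithLp.toLp 2 p)‖ = Real.sqrt (p.1 ^ 2 + ‖p.2‖ ^ 2) := fun p => by
    rw [LinearIsometryEquiv.norm_map, WithLp.prod_norm_eq_of_L2]
    simp
  let H : ℝ × EuclideanSpace ℝ (Fin 2) → ℂ := fun p =>
    Real.fourierChar (-(‖ξ‖ * p.1)) • cutoffProfile k R (Real.sqrt (p.1 ^ 2 + ‖p.2‖ ^ 2))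
  have hF : 𝓕 (cutoffKernel k R) ξ = ∫ p, H p := by
    conv_lhs => rw [← hA, ← Real.fourier_comp_linearIsometry, Real.fourier_eq,
      ← hmp.integral_comp hme]
    refine integral_congr_ae (.of_forall fun p => ?_)
    simp only [H, Function.comp_apply, cutoffKernel, hnorm]
    simp [WithLp.prod_inner_apply]
  have hHint : Integrable H := by
    have h1 : Integrable (fun p : ℝ × EuclideanSpace ℝ (Fin 2) =>
        cutoffProfile k R (Real.sqrt (p.1 ^ 2 + ‖p.2‖ ^ 2))) := by
      have h2 := (hmp.integrable_comp_emb hme).2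
        ((A.measurePreserving.integrable_comp_emb
          A.toHomeomorph.measurableEmbedding).2 (integrable_cutoffKernel k R))
      simpa only [Function.comp_def, cutoffKernel, hnorm] using h2
    refine h1.mono ?_ (.of_forall fun p => by simp [H])
    exact (Real.continuous_fourierChar.comp
      (by fun_prop)).aestronglyMeasurable.smul h1.aestronglyMeasurable
  rw [hF, Measure.volume_eq_prod, integral_prod _ hHint]
  have hbound : ∀ᵐ t : ℝ, ‖∫ η, H (t, η)‖ ≤ (Set.Icc (-R) R).indicator (fun _ => 1 / k) t := by
    filter_upwards [compl_mem_ae_iff.2 (measure_singleton (0 : ℝ))] with t ht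
    have h3 : ∫ η, H (t, η) = Real.fourierChar (-(‖ξ‖ * t)) •
        ∫ η : EuclideanSpace ℝ (Fin 2), cutoffProfile k R (Real.sqrt (t ^ 2 + ‖η‖ ^ 2)) := by
      simp only [H, Circle.smul_def]
      exact integral_smul _ _
    rw [h3, Circle.norm_smul]
    exact norm_integral_slice_le hk ht
  have hi : Integrable ((Set.Icc (-R) R).indicator fun _ : ℝ => 1 / k) := by
    rw [integrable_indicator_iff measurableSet_Icc]
    exact integrableOn_const (by simp)
  refine (norm_integral_le_of_norm_le hi hbound).trans (le_of_eq ?_)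
  rw [integral_indicator measurableSet_Icc, setIntegral_const, Real.volume_real_Icc_of_le (by linarith)]
  simp only [smul_eq_mul]
  ring

/-! ### Decay of the resolvent on a bounded set. -/

section Resolvent

variable {D : Set E3} {ρ : ℝ}

/-- Points of `D` are at distance at most `2ρ`, so the cut-off is invisible there and the resolvent
becomes a convolution with an integrable kernel. -/
theorem fundamentalSolution_mul_eq (hD : D ⊆ Metric.closedBall 0 ρ) (k : ℝ) {φ : E3 → ℂ}
    (hφ : ∀ y ∉ D, φ y = 0) {x : E3} (hx : x ∈ D) (y : E3) :
    fundamentalSolution k x y * φ y = cutoffKernel k (2 * ρ) (x - y) * φ y := by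
  by_cases hy : y ∈ D
  · have h1 := mem_closedBall_zero_iff.1 (hD hx)
    have h2 := mem_closedBall_zero_iff.1 (hD hy)
    have h3 : ‖x - y‖ ≤ 2 * ρ := by linarith [norm_sub_le x y]
    simp only [cutoffKernel, cutoffProfile, fundamentalSolution, if_pos h3]
  · rw [hφ y hy, mul_zero, mul_zero]

theorem integrable_fundamentalSolution_mul (hD : D ⊆ Metric.closedBall 0 ρ) (k : ℝ) {φ : E3 → ℂ}
    (hφ : ∀ y ∉ D, φ y = 0) (hφ2 : MemLp φ 2) {x : E3} (hx : x ∈ D) :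
    Integrable (fun y => fundamentalSolution k x y * φ y) := by
  have h : MemLp (fun y => cutoffKernel k (2 * ρ) (x - y)) 2 :=
    (memLp_two_cutoffKernel k (2 * ρ)).comp_measurePreserving
      (Measure.measurePreserving_sub_left volume x)
  refine (h.integrable_mul hφ2).congr (.of_forall fun y => ?_)
  exact (fundamentalSolution_mul_eq hD k hφ hx y).symm

open Convolution in
/-- The `O(1 / k)` decay of the resolvent between `L²` spaces over a bounded set. -/
theorem eLpNorm_resolvent_le (hDm : MeasurableSet D) (hρ : 0 ≤ ρ)
    (hD : D ⊆ Metric.closedBall 0 ρ) {k : ℝ} (hk : 0 < k) {φ : E3 → ℂ}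
    (hφ : ∀ y ∉ D, φ y = 0) (hφ2 : MemLp φ 2) :
    eLpNorm (resolvent k φ) 2 (volume.restrict D) ≤
      ENNReal.ofReal (4 * ρ / k) * eLpNorm φ 2 volume := by
  have hDfin : volume D ≠ ∞ := (Metric.isBounded_closedBall.subset hD).measure_lt_top.ne
  have hφ1 : Integrable φ := by
    have : D.indicator φ = φ := Set.indicator_eq_self.2 fun y hy => by_contra fun h => hy (hφ y h)
    rw [← this, integrable_indicator_iff hDm]
    have : IsFiniteMeasure (volume.restrict D) := ⟨by simpa using hDfin.lt_top⟩
    exact (hφ2.restrict D).integrable (by norm_num)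
  have h1 : eLpNorm (resolvent k φ) 2 (volume.restrict D) =
      eLpNorm (cutoffKernel k (2 * ρ) ⋆[ContinuousLinearMap.mul ℂ ℂ] φ) 2 (volume.restrict D) := by
    refine eLpNorm_congr_ae ((ae_restrict_iff' hDm).2 (.of_forall fun x hx => ?_))
    rw [convolution_eq_swap, resolvent]
    exact integral_congr_ae (.of_forall fun y => fundamentalSolution_mul_eq hD k hφ hx y)
  rw [h1]
  refine (eLpNorm_mono_measure _ Measure.restrict_le_self).trans
    (eLpNorm_convolution_le_of_norm_fourier_le (integrable_cutoffKernel _ _)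
      (memLp_two_cutoffKernel _ _) (fun ξ => ?_) hφ1 hφ2)
  refine (norm_fourier_cutoffKernel_le hk (by positivity) ξ).trans (le_of_eq ?_)
  ring

end Resolvent

/-! ### Plane waves, weighted spaces and multiplication by coefficients. -/

theorem norm_planeWave (k : ℝ) (d : S2) (x : E3) : ‖planeWave k d x‖ = 1 :=
  norm_exp_I_mul_ofReal _

theorem continuous_planeWave (k : ℝ) (d : S2) : Continuous (planeWave k d) := by
  unfold planeWave
  fun_prop

/-- The weight is continuous and positive, so its inverse is bounded on a closed ball containing
`D`. -/
theorem MemWeightedL2.memLp_restrict {s : ℝ} {u : E3 → ℂ} (hu : MemWeightedL2 s u) {D : Set E3}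
    (hDm : MeasurableSet D) (hDb : Bornology.IsBounded D) : MemLp u 2 (volume.restrict D) := by
  obtain ⟨ρ, hρ⟩ := hDb.subset_closedBall 0
  let a : E3 → ℝ := fun x => Real.sqrt (1 + ‖x‖ ^ 2) ^ s
  have hpos : ∀ x : E3, 0 < Real.sqrt (1 + ‖x‖ ^ 2) := fun x => Real.sqrt_pos.2 (by positivity)
  have ha : ∀ x, 0 < a x := fun x => Real.rpow_pos_of_pos (hpos x) s
  have hac : Continuous a := by
    refine Continuous.rpow_const (by fun_prop) fun x => Or.inl (hpos x).ne'
  obtain ⟨C, hC⟩ := (isCompact_closedBall (0 : E3) ρ).bddAbove_image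
    (f := fun x => (a x)⁻¹) (hac.inv₀ fun x => (ha x).ne').continuousOn
  have hae : ∀ x, u x = ((a x)⁻¹ : ℝ) * ((a x : ℂ) * u x) := fun x => by
    have : (a x : ℂ) ≠ 0 := by exact_mod_cast (ha x).ne'
    push_cast
    field_simp
  have hu' : MemLp (fun x => (a x : ℂ) * u x) 2 volume := hu
  refine (hu'.restrict D).of_le_mul (c := C) ?_ ?_
  · rw [show u = fun x => (((a x)⁻¹ : ℝ) : ℂ) * ((a x : ℂ) * u x) from funext hae]
    exact (Complex.continuous_ofReal.comp
      (hac.inv₀ fun x => (ha x).ne')).aestronglyMeasurable.mul (hu'.restrict D).1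
  · refine (ae_restrict_iff' hDm).2 (.of_forall fun x hx => ?_)
    conv_lhs => rw [hae x, norm_mul, Complex.norm_real, Real.norm_of_nonneg (inv_nonneg.2 (ha x).le)]
    exact mul_le_mul_of_nonneg_right (hC ⟨x, hρ hx, rfl⟩) (norm_nonneg _)

namespace IsCoefficient

variable {D : Set E3} {V : E3 → ℝ}

theorem eq_zero_of_notMem (hV : IsCoefficient D V) {x : E3} (hx : x ∉ D) : V x = 0 :=
  image_eq_zero_of_notMem_tsupport fun h => hx (hV.tsupport_subset h)

theorem exists_ae_bound (hV : IsCoefficient D V) : ∃ M : ℝ, 0 ≤ M ∧ ∀ᵐ x, ‖V x‖ ≤ M := by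
  refine ⟨(eLpNormEssSup V volume).toReal, ENNReal.toReal_nonneg, ?_⟩
  have hfin : eLpNormEssSup V volume ≠ ∞ := by
    rw [← eLpNorm_exponent_top]
    exact hV.memLp_top.2.ne
  filter_upwards [enorm_ae_le_eLpNormEssSup V volume] with x hx
  rw [← toReal_enorm]
  exact ENNReal.toReal_mono hfin hx

theorem memLp_mul (hV : IsCoefficient D V) {h : E3 → ℂ} (hh : MemLp h 2 (volume.restrict D)) :
    MemLp (fun y => (V y : ℂ) * h y) 2 (volume.restrict D) := by
  obtain ⟨M, -, hM⟩ := hV.exists_ae_bound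
  refine hh.of_le_mul (c := M) ?_ ?_
  · exact (Complex.continuous_ofReal.comp_aestronglyMeasurable hV.memLp_top.1).restrict.mul hh.1
  · filter_upwards [ae_restrict_of_ae hM] with x hx
    rw [norm_mul, Complex.norm_real]
    exact mul_le_mul_of_nonneg_right hx (norm_nonneg _)

theorem indicator_mul_eq (hV : IsCoefficient D V) (h : E3 → ℂ) :
    D.indicator (fun y => (V y : ℂ) * h y) = fun y => (V y : ℂ) * h y :=
  Set.indicator_eq_self.2 fun y hy => by_contra fun hn => hy (by simp [hV.eq_zero_of_notMem hn])

theorem memLp_mul_volume (hV : IsCoefficient D V) (hDm : MeasurableSet D) {h : E3 → ℂ}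
    (hh : MemLp h 2 (volume.restrict D)) : MemLp (fun y => (V y : ℂ) * h y) 2 := by
  rw [← hV.indicator_mul_eq h, memLp_indicator_iff_restrict hDm]
  exact hV.memLp_mul hh

theorem eLpNorm_mul_le (hV : IsCoefficient D V) (hDm : MeasurableSet D) {M : ℝ}
    (hM : ∀ᵐ x, ‖V x‖ ≤ M) (h : E3 → ℂ) :
    eLpNorm (fun y => (V y : ℂ) * h y) 2 volume ≤
      ENNReal.ofReal M * eLpNorm h 2 (volume.restrict D) := by
  rw [← hV.indicator_mul_eq h, eLpNorm_indicator_eq_eLpNorm_restrict hDm]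
  refine eLpNorm_le_mul_eLpNorm_of_ae_le_mul ?_ 2
  filter_upwards [ae_restrict_of_ae hM] with x hx
  rw [norm_mul, Complex.norm_real]
  exact mul_le_mul_of_nonneg_right hx (norm_nonneg _)

end IsCoefficient

/-! ### Differences of scattered waves and of far fields. -/

variable {D : Set E3} {V f : E3 → ℝ}

theorem memLp_planeWave [IsFiniteMeasure (volume.restrict D)] (p : ℝ≥0∞) (k : ℝ) (d : S2) :
    MemLp (planeWave k d) p (volume.restrict D) :=
  MemLp.of_bound (continuous_planeWave k d).aestronglyMeasurable 1
    (.of_forall fun x => (norm_planeWave k d x).le)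

/-- The difference of two scattered waves for the same source and noise solves the
Lippmann–Schwinger equation of the passive system. -/
theorem IsScatteredWave.sub_ae_eq_resolvent (hDm : MeasurableSet D)
    (hDb : Bornology.IsBounded D) (hV : IsCoefficient D V) {g : E3 → ℂ} {k : ℝ} {d₁ d₂ : S2}
    {u₁ u₂ : E3 → ℂ} (h₁ : IsScatteredWave V f g k d₁ u₁) (h₂ : IsScatteredWave V f g k d₂ u₂) :
    (fun x => u₁ x - u₂ x) =ᵐ[volume.restrict D]
      resolvent k fun y => (V y : ℂ) * ((planeWave k d₁ y - planeWave k d₂ y) + (u₁ y - u₂ y)) := by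
  obtain ⟨ρ, hρ⟩ := hDb.subset_closedBall 0
  have : IsFiniteMeasure (volume.restrict D) := ⟨by simpa using hDb.measure_lt_top⟩
  have hu₁ := (h₁.memWeightedL2 1 one_pos).memLp_restrict hDm hDb
  have hu₂ := (h₂.memWeightedL2 1 one_pos).memLp_restrict hDm hDb
  have hint : ∀ {h : E3 → ℂ}, MemLp h 2 (volume.restrict D) → ∀ x ∈ D,
      Integrable (fun y => fundamentalSolution k x y * ((V y : ℂ) * h y)) := fun hh x hx =>
    integrable_fundamentalSolution_mul hρ k (fun y hy => by simp [hV.eq_zero_of_notMem hy])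
      (hV.memLp_mul_volume hDm hh) hx
  filter_upwards [ae_restrict_mem hDm, ae_restrict_of_ae h₁.lippmannSchwinger,
    ae_restrict_of_ae h₂.lippmannSchwinger] with x hx e₁ e₂
  have i₁ := hint hu₁ x hx
  have i₂ := hint hu₂ x hx
  have j₁ := hint (memLp_planeWave 2 k d₁) x hx
  have j₂ := hint (memLp_planeWave 2 k d₂) x hx
  have hsplit : resolvent k (fun y => (V y : ℂ) *
      ((planeWave k d₁ y - planeWave k d₂ y) + (u₁ y - u₂ y))) x =
      (resolvent k (fun y => (V y : ℂ) * planeWave k d₁ y) x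
        - resolvent k (fun y => (V y : ℂ) * planeWave k d₂ y) x)
      + (resolvent k (fun y => (V y : ℂ) * u₁ y) x
        - resolvent k (fun y => (V y : ℂ) * u₂ y) x) := by
    simp only [resolvent]
    have j := j₁.sub j₂
    have i := i₁.sub i₂
    rw [Pi.sub_def] at i j
    rw [← integral_sub j₁ j₂, ← integral_sub i₁ i₂, ← integral_add j i]
    exact integral_congr_ae (.of_forall fun y => by ring)
  rw [hsplit]
  linear_combination e₁ - e₂

/-- Scattered waves for the same source and noise differ by `O(1 / k)` in `L²(D)`. -/
theorem exists_eLpNorm_sub_le (hDm : MeasurableSet D) (hDb : Bornology.IsBounded D)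
    (hV : IsCoefficient D V) :
    ∃ C K : ℝ, 0 ≤ C ∧ 0 < K ∧ ∀ (f : E3 → ℝ) (g : E3 → ℂ) (k : ℝ), K < k →
      ∀ (d₁ d₂ : S2) (u₁ u₂ : E3 → ℂ),
        IsScatteredWave V f g k d₁ u₁ → IsScatteredWave V f g k d₂ u₂ →
        (eLpNorm (fun x => u₁ x - u₂ x) 2 (volume.restrict D)).toReal ≤ C / k := by
  obtain ⟨r, hr⟩ := hDb.subset_closedBall 0
  have hρ : D ⊆ Metric.closedBall 0 (max r 0) :=
    hr.trans (Metric.closedBall_subset_closedBall (le_max_left _ _))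
  set ρ := max r 0
  have hρ0 : 0 ≤ ρ := le_max_right _ _
  have : IsFiniteMeasure (volume.restrict D) := ⟨by simpa using hDb.measure_lt_top⟩
  obtain ⟨M, hM0, hM⟩ := hV.exists_ae_bound
  let B : ℝ≥0∞ := (volume.restrict D) Set.univ ^ ((2 : ℝ≥0∞).toReal⁻¹) * ENNReal.ofReal 2
  have hB : B ≠ ∞ := by
    refine ENNReal.mul_ne_top (ENNReal.rpow_ne_top_of_nonneg (by simp) (measure_ne_top _ _)) ?_
    exact ENNReal.ofReal_ne_top
  -- The estimate below reads `k a ≤ 4ρM (B + a)`, where `a` is the norm of the difference. For `k >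
  -- 8ρM` the term `4ρM a` is at most `k a / 2`, whence `k a ≤ 8ρM B`. The extra `1` keeps the
  -- threshold positive.
  refine ⟨8 * ρ * M * B.toReal, 8 * ρ * M + 1, by positivity, by positivity, ?_⟩
  intro f g k hk d₁ d₂ u₁ u₂ h₁ h₂
  have hk0 : 0 < k := lt_trans (by positivity) hk
  have hu₁ := (h₁.memWeightedL2 1 one_pos).memLp_restrict hDm hDb
  have hu₂ := (h₂.memWeightedL2 1 one_pos).memLp_restrict hDm hDb
  have hw : MemLp (fun x => u₁ x - u₂ x) 2 (volume.restrict D) := hu₁.sub hu₂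
  have hp : MemLp (fun x => planeWave k d₁ x - planeWave k d₂ x) 2 (volume.restrict D) :=
    (memLp_planeWave 2 k d₁).sub (memLp_planeWave 2 k d₂)
  have hpB : eLpNorm (fun x => planeWave k d₁ x - planeWave k d₂ x) 2 (volume.restrict D) ≤ B := by
    refine eLpNorm_le_of_ae_bound (.of_forall fun x => (norm_sub_le _ _).trans ?_)
    rw [norm_planeWave, norm_planeWave]
    norm_num
  have hsum := hp.add hw
  have key : eLpNorm (fun x => u₁ x - u₂ x) 2 (volume.restrict D) ≤
      ENNReal.ofReal (4 * ρ / k) * (ENNReal.ofReal M *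
        (B + eLpNorm (fun x => u₁ x - u₂ x) 2 (volume.restrict D))) := by
    conv_lhs => rw [eLpNorm_congr_ae (h₁.sub_ae_eq_resolvent hDm hDb hV h₂)]
    refine (eLpNorm_resolvent_le hDm hρ0 hρ hk0 (fun y hy => by simp [hV.eq_zero_of_notMem hy])
      (hV.memLp_mul_volume hDm hsum)).trans ?_
    gcongr
    refine (hV.eLpNorm_mul_le hDm hM _).trans ?_
    gcongr
    refine (eLpNorm_add_le hp.1 hw.1 (by norm_num)).trans ?_
    gcongr
  set a := eLpNorm (fun x => u₁ x - u₂ x) 2 (volume.restrict D)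
  have ha : a ≠ ∞ := hw.2.ne
  have keyR : a.toReal ≤ 4 * ρ / k * (M * (B.toReal + a.toReal)) := by
    have h := ENNReal.toReal_mono (by finiteness) key
    rwa [ENNReal.toReal_mul, ENNReal.toReal_mul, ENNReal.toReal_add hB ha,
      ENNReal.toReal_ofReal (by positivity), ENNReal.toReal_ofReal hM0] at h
  have ha0 : 0 ≤ a.toReal := ENNReal.toReal_nonneg
  have hB0 : 0 ≤ B.toReal := ENNReal.toReal_nonneg
  rw [le_div_iff₀ hk0]
  have h3 : a.toReal * k ≤ 4 * ρ * M * (B.toReal + a.toReal) := by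
    calc a.toReal * k ≤ 4 * ρ / k * (M * (B.toReal + a.toReal)) * k := by gcongr
      _ = 4 * ρ * M * (B.toReal + a.toReal) := by field_simp
  -- Absorption of `4ρM a` into the left side, possible because `a` is finite.
  nlinarith

/-- The two phases combine into one at frequency `k(xhat - d)`; the constant is `1/(4π) = √(π/2)
(2π)^(-3/2)`. -/
theorem integral_planeWave_mul (hV : IsCoefficient D V) (k : ℝ)
    (xhat d : S2) :
    1 / (4 * Real.pi : ℝ) * ∫ y in D, planeWave (-k) xhat y * ((V y : ℂ) * planeWave k d y) =
      (Real.sqrt (Real.pi / 2) : ℂ) * fourierHat V (k • ((xhat : E3) - (d : E3))) := by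
  have hconst : (1 / (4 * Real.pi : ℝ) : ℝ) =
      Real.sqrt (Real.pi / 2) * (2 * Real.pi) ^ (-(3 / 2) : ℝ) := by
    have h2 : (2 * Real.pi) ^ (-(3 / 2) : ℝ) = (Real.sqrt (2 * Real.pi) ^ 3)⁻¹ := by
      rw [Real.rpow_neg (by positivity), Real.sqrt_eq_rpow, ← Real.rpow_natCast, ← Real.rpow_mul
        (by positivity)]
      norm_num
    have h3 : Real.sqrt (2 * Real.pi) = 2 * Real.sqrt (Real.pi / 2) := by
      rw [show 2 * Real.pi = 2 ^ 2 * (Real.pi / 2) by ring, Real.sqrt_mul (by positivity),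
        Real.sqrt_sq (by norm_num)]
    have h4 : Real.sqrt (Real.pi / 2) ^ 2 = Real.pi / 2 := Real.sq_sqrt (by positivity)
    have h5 : Real.sqrt (Real.pi / 2) ≠ 0 := by positivity
    rw [h2, h3]
    field_simp
    rw [h4]
    ring
  have hint : ∫ y in D, planeWave (-k) xhat y * ((V y : ℂ) * planeWave k d y) =
      ∫ x, Complex.exp (-Complex.I * (inner ℝ (k • ((xhat : E3) - (d : E3))) x : ℝ)) * (V x : ℂ) := by
    rw [setIntegral_eq_integral_of_forall_compl_eq_zero
      fun x hx => by simp [hV.eq_zero_of_notMem hx]]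
    refine integral_congr_ae (.of_forall fun x => ?_)
    simp only [planeWave]
    rw [mul_comm (V x : ℂ), ← mul_assoc, ← Complex.exp_add, inner_smul_left, inner_sub_left,
      real_inner_comm x, real_inner_comm x]
    congr 2
    push_cast
    simp
    ring
  rw [hint, fourierHat, ← mul_assoc, ← Complex.ofReal_mul, ← hconst]
  push_cast
  rfl

/-- Differences of far-field patterns for the same source and noise are given by the Born
approximation up to `O(1 / k)`. -/
theorem exists_norm_farField_sub_le (hD : IsBoundedDomain D) (hV : IsCoefficient D V)
    (hf : IsCoefficient D f) :
    ∃ C K : ℝ, 0 < K ∧ ∀ (g : E3 → ℂ) (n : ℂ) (k : ℝ), K < k → ∀ (xhat d₁ d₂ : S2)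
      (u₁ u₂ : E3 → ℂ), IsScatteredWave V f g k d₁ u₁ → IsScatteredWave V f g k d₂ u₂ →
      ‖farField D V f k xhat d₁ u₁ n - farField D V f k xhat d₂ u₂ n
          - (Real.sqrt (Real.pi / 2) : ℂ) *
            (fourierHat V (k • ((xhat : E3) - (d₁ : E3)))
              - fourierHat V (k • ((xhat : E3) - (d₂ : E3))))‖ ≤ C / k := by
  have hDm := hD.isOpen.measurableSet
  have hDb := hD.isBounded
  have : IsFiniteMeasure (volume.restrict D) := ⟨by simpa using hDb.measure_lt_top⟩
  obtain ⟨C, K, hC, hK, hmain⟩ := exists_eLpNorm_sub_le hDm hDb hV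
  obtain ⟨M, hM0, hM⟩ := hV.exists_ae_bound
  -- The factor `|D|^(1/2)` from Hölder's inequality, which passes from `L²(D)` to `L¹(D)`.
  let B : ℝ≥0∞ := (volume.restrict D) Set.univ ^ (1 / (1 : ℝ≥0∞).toReal - 1 / (2 : ℝ≥0∞).toReal)
  have hB : B ≠ ∞ := ENNReal.rpow_ne_top_of_nonneg (by norm_num) (measure_ne_top _ _)
  refine ⟨1 / (4 * Real.pi) * (M * C * B.toReal), K, hK, ?_⟩
  intro g n k hk xhat d₁ d₂ u₁ u₂ h₁ h₂
  have hk0 : 0 < k := hK.trans hk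
  have hu₁ := (h₁.memWeightedL2 1 one_pos).memLp_restrict hDm hDb
  have hu₂ := (h₂.memWeightedL2 1 one_pos).memLp_restrict hDm hDb
  have hw : MemLp (fun x => u₁ x - u₂ x) 2 (volume.restrict D) := hu₁.sub hu₂
  have hpw : ∀ {h : E3 → ℂ}, Integrable h (volume.restrict D) →
      Integrable (fun y => planeWave (-k) xhat y * h y) (volume.restrict D) := fun hh =>
    hh.bdd_mul (continuous_planeWave _ _).aestronglyMeasurable
      (.of_forall fun x => (norm_planeWave (-k) xhat x).le)
  have hVi : ∀ {h : E3 → ℂ}, MemLp h 2 (volume.restrict D) →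
      Integrable (fun y => (V y : ℂ) * h y) (volume.restrict D) := fun hh =>
    (hV.memLp_mul hh).integrable (by norm_num)
  have hfi : Integrable (fun y => (f y : ℂ)) (volume.restrict D) :=
    ((hf.memLp_top.restrict D).integrable le_top).ofReal
  have hsplit : ∀ {d : S2} {u : E3 → ℂ}, MemLp u 2 (volume.restrict D) →
      ∫ y in D, planeWave (-k) xhat y *
        ((V y : ℂ) * planeWave k d y - (f y : ℂ) + (V y : ℂ) * u y) =
      (∫ y in D, planeWave (-k) xhat y * ((V y : ℂ) * planeWave k d y))
      - (∫ y in D, planeWave (-k) xhat y * (f y : ℂ))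
      + ∫ y in D, planeWave (-k) xhat y * ((V y : ℂ) * u y) := fun {d u} hu => by
    have i₁ := hpw (hVi (memLp_planeWave 2 k d))
    have i₂ := i₁.sub (hpw hfi)
    rw [Pi.sub_def] at i₂
    rw [← integral_sub i₁ (hpw hfi), ← integral_add i₂ (hpw (hVi hu))]
    exact integral_congr_ae (.of_forall fun y => by ring)
  have hsub : (∫ y in D, planeWave (-k) xhat y * ((V y : ℂ) * u₁ y)) -
      ∫ y in D, planeWave (-k) xhat y * ((V y : ℂ) * u₂ y) =
      ∫ y in D, planeWave (-k) xhat y * ((V y : ℂ) * (u₁ y - u₂ y)) := by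
    rw [← integral_sub (hpw (hVi hu₁)) (hpw (hVi hu₂))]
    exact integral_congr_ae (.of_forall fun y => by ring)
  -- The source integral and the noise value `n` do not depend on the incident direction and cancel;
  -- only the term in `u₁ - u₂` goes beyond Born.
  have hrem : farField D V f k xhat d₁ u₁ n - farField D V f k xhat d₂ u₂ n
      - (Real.sqrt (Real.pi / 2) : ℂ) * (fourierHat V (k • ((xhat : E3) - (d₁ : E3)))
        - fourierHat V (k • ((xhat : E3) - (d₂ : E3)))) =
      ((1 / (4 * Real.pi) : ℝ) : ℂ) *
        ∫ y in D, planeWave (-k) xhat y * ((V y : ℂ) * (u₁ y - u₂ y)) := by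
    rw [mul_sub, ← integral_planeWave_mul hV, ← integral_planeWave_mul hV, farField,
      farField, hsplit hu₁, hsplit hu₂, ← hsub]
    push_cast
    ring
  rw [hrem, norm_mul, Complex.norm_real, Real.norm_of_nonneg (by positivity), mul_div_assoc]
  gcongr
  have hVw := hV.memLp_mul hw
  calc ‖∫ y in D, planeWave (-k) xhat y * ((V y : ℂ) * (u₁ y - u₂ y))‖
      ≤ ∫ y in D, ‖(V y : ℂ) * (u₁ y - u₂ y)‖ := by
        refine norm_integral_le_of_norm_le (hVi hw).norm (.of_forall fun y => ?_)
        rw [norm_mul, norm_planeWave, one_mul]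
    _ = (eLpNorm (fun y => (V y : ℂ) * (u₁ y - u₂ y)) 1 (volume.restrict D)).toReal := by
        rw [integral_norm_eq_lintegral_enorm hVw.1, eLpNorm_one_eq_lintegral_enorm]
    _ ≤ (ENNReal.ofReal M * eLpNorm (fun y => u₁ y - u₂ y) 2 (volume.restrict D) * B).toReal := by
        refine ENNReal.toReal_mono (ENNReal.mul_ne_top
          (ENNReal.mul_ne_top ENNReal.ofReal_ne_top hw.2.ne) hB) ?_
        refine (eLpNorm_le_eLpNorm_mul_rpow_measure_univ (p := 1) (q := 2) (by norm_num)
          hVw.1).trans ?_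
        gcongr
        exact (eLpNorm_mono_measure _ Measure.restrict_le_self).trans (hV.eLpNorm_mul_le hDm hM _)
    _ = M * (eLpNorm (fun y => u₁ y - u₂ y) 2 (volume.restrict D)).toReal * B.toReal := by
        rw [ENNReal.toReal_mul, ENNReal.toReal_mul, ENNReal.toReal_ofReal hM0]
    _ ≤ M * (C / k) * B.toReal := by
        gcongr
        exact hmain f g k hk d₁ d₂ u₁ u₂ h₁ h₂
    _ = M * C * B.toReal / k := by ring

/-! ### Continuity, decay and injectivity of the Fourier transform. -/

section FourierHat

open FourierTransform

variable {D : Set E3} {V : E3 → ℝ}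

theorem fourierHat_eq_fourier (g : E3 → ℝ) (p : E3) :
    fourierHat g p = (((2 * Real.pi) ^ (-(3 / 2) : ℝ) : ℝ) : ℂ) *
      𝓕 (fun x => (g x : ℂ)) ((2 * Real.pi)⁻¹ • p) := by
  rw [fourierHat, Real.fourier_eq']
  congr 1
  refine integral_congr_ae (.of_forall fun x => ?_)
  have hπ : (Real.pi : ℂ) ≠ 0 := by exact_mod_cast Real.pi_ne_zero
  simp only [smul_eq_mul, inner_smul_right]
  rw [real_inner_comm x p]
  congr 2
  push_cast
  field_simp

theorem IsCoefficient.integrable (hV : IsCoefficient D V) : Integrable V :=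
  integrableOn_iff_integrable_of_support_subset (subset_tsupport V) |>.1 <|
    have : IsFiniteMeasure (volume.restrict (tsupport V)) :=
      ⟨by simpa using hV.hasCompactSupport.isCompact.measure_lt_top⟩
    (hV.memLp_top.restrict _).integrable le_top

theorem IsCoefficient.memLp_two (hV : IsCoefficient D V) : MemLp V 2 := by
  obtain ⟨M, -, hM⟩ := hV.exists_ae_bound
  rw [memLp_two_iff_integrable_sq hV.memLp_top.1]
  simp only [sq]
  exact hV.integrable.bdd_mul hV.memLp_top.1 hM

theorem continuous_fourierHat (hV : IsCoefficient D V) : Continuous (fourierHat V) := by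
  rw [show fourierHat V = _ from funext (fourierHat_eq_fourier V)]
  exact continuous_const.mul ((continuous_fourier_of_integrable hV.integrable.ofReal).comp
    (continuous_const_smul _))

/-- The **Riemann–Lebesgue lemma**. -/
theorem tendsto_fourierHat_cobounded (V : E3 → ℝ) :
    Tendsto (fourierHat V) (Bornology.cobounded E3) (𝓝 0) := by
  have h1 : Tendsto (𝓕 fun x => (V x : ℂ)) (cocompact E3) (𝓝 0) :=
    tendsto_integral_exp_inner_smul_cocompact _
  have h2 : Tendsto (fun p : E3 => (2 * Real.pi)⁻¹ • p) (cocompact E3) (cocompact E3) :=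
    (Homeomorph.smulOfNeZero ((2 * Real.pi)⁻¹) (by positivity)).isClosedEmbedding.tendsto_cocompact
  rw [Metric.cobounded_eq_cocompact, show fourierHat V = _ from funext (fourierHat_eq_fourier V)]
  simpa using (h1.comp h2).const_mul (((2 * Real.pi) ^ (-(3 / 2) : ℝ) : ℝ) : ℂ)

/-- A coefficient is determined by the values of its Fourier transform on a dense set. -/
theorem IsCoefficient.ae_eq_of_fourierHat_eq {D' : Set E3} {V' : E3 → ℝ} (hV : IsCoefficient D V)
    (hV' : IsCoefficient D' V') {ι : Type*} {q : ι → E3} (hq : DenseRange q)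
    (h : ∀ i, fourierHat V (q i) = fourierHat V' (q i)) : V =ᵐ[volume] V' := by
  -- By continuity a dense set of frequencies suffices; in the application it is countable.
  have heq : fourierHat V = fourierHat V' :=
    hq.equalizer (continuous_fourierHat hV) (continuous_fourierHat hV') (funext h)
  have hc : (((2 * Real.pi) ^ (-(3 / 2) : ℝ) : ℝ) : ℂ) ≠ 0 := by
    exact_mod_cast (Real.rpow_pos_of_pos (by positivity) _).ne'
  have hF : ∀ p, 𝓕 (fun x => (V x : ℂ)) p = 𝓕 (fun x => (V' x : ℂ)) p := fun p => by
    have h1 := congrFun heq ((2 * Real.pi) • p)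
    rw [fourierHat_eq_fourier, fourierHat_eq_fourier, inv_smul_smul₀ (by positivity)] at h1
    exact mul_left_cancel₀ hc h1
  have hi : Integrable (fun x => (V x : ℂ)) := hV.integrable.ofReal
  have hi' : Integrable (fun x => (V' x : ℂ)) := hV'.integrable.ofReal
  have h0 := ae_eq_zero_of_fourier_eq_zero (f := fun x => (V x : ℂ) - (V' x : ℂ)) (hi.sub hi')
    (hV.memLp_two.ofReal.sub hV'.memLp_two.ofReal) fun p => by
      have i₁ := (Real.fourierIntegral_convergent_iff p).2 hi
      have i₂ := (Real.fourierIntegral_convergent_iff p).2 hi'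
      rw [Real.fourier_eq]
      simp only [smul_sub]
      rw [integral_sub i₁ i₂, ← Real.fourier_eq, ← Real.fourier_eq, hF p, sub_self]
  filter_upwards [h0] with x hx
  exact_mod_cast sub_eq_zero.1 hx

end FourierHat

/-! ### Admissible directions. -/

section Directions

theorem exists_norm_eq_one_inner_eq_zero (p : E3) : ∃ e : E3, ‖e‖ = 1 ∧ inner ℝ e p = 0 := by
  have h1 := Submodule.finrank_add_finrank_orthogonal (Submodule.span ℝ {p})
  have h2 := finrank_span_le_card (R := ℝ) ({p} : Set E3)
  rw [finrank_euclideanSpace, Fintype.card_fin] at h1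
  simp only [Set.toFinset_singleton, Finset.card_singleton] at h2
  have : Nontrivial (Submodule.span ℝ {p})ᗮ := 
    Module.finrank_pos_iff (R := ℝ) |>.1 (by omega)
  obtain ⟨⟨v, hv⟩, hv0⟩ := exists_ne (0 : (Submodule.span ℝ {p})ᗮ)
  have hv0 : v ≠ 0 := fun h => hv0 (Subtype.ext h)
  refine ⟨‖v‖⁻¹ • v, ?_, ?_⟩
  · rw [norm_smul, norm_inv, norm_norm, inv_mul_cancel₀ (norm_ne_zero_iff.2 hv0)]
  · rw [inner_smul_left, Submodule.mem_orthogonal_singleton_iff_inner_left.1 hv, mul_zero]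

/-- With a unit vector `e ⊥ p`, take `xhat = a e + p/(2k)`, `d₁ = a e - p/(2k)` and `d₂ = -xhat`. By
Pythagoras `a² = 1 - (‖p‖/(2k))²` gives unit vectors, which requires `‖p‖ ≤ 2k`. -/
theorem exists_directions (p : E3) (k : ℝ) : ∃ xhat d₁ d₂ : S2, 0 < k → ‖p‖ ≤ 2 * k →
    k • ((xhat : E3) - (d₁ : E3)) = p ∧ ‖k • ((xhat : E3) - (d₂ : E3))‖ = 2 * k := by
  obtain ⟨e, he, hep⟩ := exists_norm_eq_one_inner_eq_zero p
  by_cases hk : 0 < k ∧ ‖p‖ ≤ 2 * k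
  swap
  · have s : S2 := ⟨e, by simpa using he⟩
    exact ⟨s, s, s, fun h1 h2 => absurd ⟨h1, h2⟩ hk⟩
  obtain ⟨hk0, hpk⟩ := hk
  set a := Real.sqrt (1 - (‖p‖ / (2 * k)) ^ 2)
  have ha : a ^ 2 = 1 - (‖p‖ / (2 * k)) ^ 2 := by
    refine Real.sq_sqrt (sub_nonneg.2 ?_)
    rw [sq_le_one_iff₀ (by positivity)]
    exact (div_le_one (by positivity)).2 hpk
  have hnorm : ∀ s : ℝ, s ^ 2 = 1 → ‖a • e + (s / (2 * k)) • p‖ = 1 := fun s hs => by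
    have h : ‖a • e + (s / (2 * k)) • p‖ ^ 2 = 1 := by
      rw [norm_add_sq_real, inner_smul_left, inner_smul_right, hep, norm_smul, norm_smul, he,
        mul_one, mul_pow, Real.norm_eq_abs, Real.norm_eq_abs, sq_abs, sq_abs, ha, div_pow s, hs]
      simp only [mul_zero, add_zero]
      ring
    exact (pow_eq_one_iff_of_nonneg (norm_nonneg _) two_ne_zero).1 h
  have h1 := hnorm 1 (by norm_num)
  have h2 := hnorm (-1) (by norm_num)
  refine ⟨⟨_, mem_sphere_zero_iff_norm.2 h1⟩, ⟨_, mem_sphere_zero_iff_norm.2 h2⟩,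
    ⟨-(a • e + ((1 : ℝ) / (2 * k)) • p), mem_sphere_zero_iff_norm.2 (by rw [norm_neg, h1])⟩,
    fun _ _ => ⟨?_, ?_⟩⟩
  · simp only [add_sub_add_left_eq_sub]
    rw [← sub_smul, smul_smul]
    convert one_smul ℝ p using 2
    field_simp
    norm_num
  · simp only [sub_neg_eq_add]
    rw [← two_smul ℝ, norm_smul, norm_smul, h1, Real.norm_of_nonneg hk0.le]
    norm_num
    ring

theorem exists_isDirectionChoice (p : E3) :
    ∃ xhat d₁ d₂ : ℝ → S2, IsDirectionChoice atTop p id xhat d₁ d₂ := by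
  choose xhat d₁ d₂ h using exists_directions p
  have hev : ∀ᶠ k : ℝ in atTop, 0 < k ∧ ‖p‖ ≤ 2 * k := by
    filter_upwards [eventually_gt_atTop 0, eventually_ge_atTop ‖p‖] with k h1 h2
    exact ⟨h1, by linarith⟩
  refine ⟨xhat, d₁, d₂, tendsto_id, hev.mono fun k hk => (h k hk.1 hk.2).1, ?_⟩
  refine (tendsto_id.const_mul_atTop two_pos).congr' (hev.mono fun k hk => ?_)
  exact (h k hk.1 hk.2).2.symm

theorem IsDirectionChoice.comp {ι ι' : Type*} {l : Filter ι} {l' : Filter ι'} {p : E3} {k : ι → ℝ}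
    {xhat d₁ d₂ : ι → S2} (h : IsDirectionChoice l p k xhat d₁ d₂) {φ : ι' → ι}
    (hφ : Tendsto φ l' l) :
    IsDirectionChoice l' p (k ∘ φ) (xhat ∘ φ) (d₁ ∘ φ) (d₂ ∘ φ) :=
  ⟨h.tendsto_waveNumber.comp hφ, hφ.eventually h.eq_frequency, h.tendsto_norm.comp hφ⟩

end Directions

/-! ### The recovery formula and the recovery map. -/

/-- The recovery formula along any filter, for the waves of a fixed sample. -/
theorem IsDirectionChoice.tendsto_farField {ι : Type*} {l : Filter ι} {p : E3} {k : ι → ℝ}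
    {xhat d₁ d₂ : ι → S2} (h : IsDirectionChoice l p k xhat d₁ d₂) {D : Set E3} {V f : E3 → ℝ}
    (hD : IsBoundedDomain D) (hV : IsCoefficient D V) (hf : IsCoefficient D f)
    {g : ι → E3 → ℂ} {n : ι → ℂ} {u₁ u₂ : ι → E3 → ℂ}
    (hu₁ : ∀ᶠ i in l, IsScatteredWave V f (g i) (k i) (d₁ i) (u₁ i))
    (hu₂ : ∀ᶠ i in l, IsScatteredWave V f (g i) (k i) (d₂ i) (u₂ i)) :
    Tendsto (fun i => (Real.sqrt (2 / Real.pi) : ℂ) *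
      (farField D V f (k i) (xhat i) (d₁ i) (u₁ i) (n i)
        - farField D V f (k i) (xhat i) (d₂ i) (u₂ i) (n i))) l (𝓝 (fourierHat V p)) := by
  obtain ⟨C, K, -, hmain⟩ := exists_norm_farField_sub_le hD hV hf
  have hb : Tendsto (fun i => C / k i) l (𝓝 0) := h.tendsto_waveNumber.const_div_atTop C
  -- The constants are uniform in `g`, `n` and the directions, so all of these may vary along the
  -- filter.
  have hrem := squeeze_zero_norm' (by
    filter_upwards [h.tendsto_waveNumber.eventually_gt_atTop K, hu₁, hu₂] with i hi h1 h2
    exact hmain (g i) (n i) (k i) hi (xhat i) (d₁ i) (d₂ i) (u₁ i) (u₂ i) h1 h2) hb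
  have hR : Tendsto (fun i => fourierHat V (k i • ((xhat i : E3) - (d₂ i : E3)))) l (𝓝 0) :=
    (tendsto_fourierHat_cobounded V).comp (tendsto_norm_atTop_iff_cobounded.1 h.tendsto_norm)
  have hP : Tendsto (fun i => fourierHat V (k i • ((xhat i : E3) - (d₁ i : E3)))) l
      (𝓝 (fourierHat V p)) :=
    tendsto_const_nhds.congr' (h.eq_frequency.mono fun i hi => by simp only [hi])
  have hs : (Real.sqrt (2 / Real.pi) : ℂ) * (Real.sqrt (Real.pi / 2) : ℂ) = 1 := by
    rw [← Complex.ofReal_mul, ← Real.sqrt_mul (by positivity),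
      show 2 / Real.pi * (Real.pi / 2) = 1 by field_simp, Real.sqrt_one, Complex.ofReal_one]
  have hlim := (hrem.const_mul (Real.sqrt (2 / Real.pi) : ℂ)).add (hP.sub hR)
  rw [mul_zero, zero_add, sub_zero] at hlim
  refine hlim.congr fun i => ?_
  linear_combination (-(fourierHat V (k i • ((xhat i : E3) - (d₁ i : E3)))
    - fourierHat V (k i • ((xhat i : E3) - (d₂ i : E3))))) * hs

section Recovery

/-- The approximation of `fourierHat V p` given by the far-field data `A` at the wave number `n`,
for a fixed admissible choice of directions. -/
def fourierApproximation (A : S2 → ℝ → S2 → ℂ) (p : E3) (n : ℕ) : ℂ :=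
  let h := exists_isDirectionChoice p
  (Real.sqrt (2 / Real.pi) : ℂ) *
    (A (h.choose n) n (h.choose_spec.choose n)
      - A (h.choose n) n (h.choose_spec.choose_spec.choose n))

/-- `V` is a coefficient whose Fourier transform is the limit of the far-field data `A` at a dense
sequence of frequencies. -/
structure IsCompatible (A : S2 → ℝ → S2 → ℂ) (V : E3 → ℝ) : Prop where
  isCoefficient : ∃ D, IsCoefficient D V
  tendsto : ∀ m, Tendsto (fourierApproximation A (TopologicalSpace.denseSeq E3 m)) atTop
    (𝓝 (fourierHat V (TopologicalSpace.denseSeq E3 m)))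

/-- Limits are unique, so both transforms agree on the dense sequence. The two domains may differ,
hence recovery needs no knowledge of `D`. -/
theorem IsCompatible.ae_eq {A : S2 → ℝ → S2 → ℂ} {V V' : E3 → ℝ} (h : IsCompatible A V)
    (h' : IsCompatible A V') : V =ᵐ[volume] V' := by
  obtain ⟨D, hV⟩ := h.isCoefficient
  obtain ⟨D', hV'⟩ := h'.isCoefficient
  exact hV.ae_eq_of_fourierHat_eq hV' (TopologicalSpace.denseRange_denseSeq E3)
    fun m => tendsto_nhds_unique (h.tendsto m) (h'.tendsto m)

open Classical in
/-- The potential recovered from far-field data: the coefficient, unique up to a null set, whose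
Fourier transform is the limit of the data. -/
def recoverPotential (A : S2 → ℝ → S2 → ℂ) : E3 → ℝ :=
  if h : ∃ V, IsCompatible A V then h.choose else 0

theorem IsCompatible.recoverPotential_ae_eq {A : S2 → ℝ → S2 → ℂ} {V : E3 → ℝ}
    (h : IsCompatible A V) : recoverPotential A =ᵐ[volume] V := by
  have hex : ∃ V, IsCompatible A V := ⟨V, h⟩
  rw [recoverPotential, dif_pos hex]
  exact hex.choose_spec.ae_eq h

end Recovery

/-! ### Almost sure statements. -/

section Data

variable {Ω : Type*} [MeasurableSpace Ω] {P : Measure Ω} {D : Set E3} {V f : E3 → ℝ}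
  {G : ℝ → E3 → Ω → ℂ} {κ : ℝ} {usc : ℝ → S2 → E3 → Ω → ℂ}

/-- The exceptional null set depends on wave number and direction. A sequence meets countably many
of them, so their union is still null. -/
theorem IsMildSolution.ae_tendsto_activeData (husc : IsMildSolution P V f G κ usc)
    (hD : IsBoundedDomain D) (hV : IsCoefficient D V) (hf : IsCoefficient D f)
    (N : ℝ → S2 → Ω → ℂ) {p : E3} {k : ℕ → ℝ} {xhat d₁ d₂ : ℕ → S2}
    (h : IsDirectionChoice atTop p k xhat d₁ d₂) :
    ∀ᵐ ω ∂P, Tendsto (fun n => (Real.sqrt (2 / Real.pi) : ℂ) *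
      (activeData D V f N usc ω (xhat n) (k n) (d₁ n)
        - activeData D V f N usc ω (xhat n) (k n) (d₂ n))) atTop (𝓝 (fourierHat V p)) := by
  have hae : ∀ d : ℕ → S2, ∀ᵐ ω ∂P, ∀ n, κ < k n →
      IsScatteredWave V f (fun x => G (k n) x ω) (k n) (d n) (fun x => usc (k n) (d n) x ω) :=
    fun d => ae_all_iff.2 fun n => by
      by_cases hn : κ < k n
      · filter_upwards [husc.isScatteredWave (k n) hn (d n)] with ω hω _ using hω
      · exact .of_forall fun ω h => absurd h hn
  have hκ := h.tendsto_waveNumber.eventually_gt_atTop κ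
  filter_upwards [hae d₁, hae d₂] with ω h₁ h₂
  exact h.tendsto_farField hD hV hf (hκ.mono fun n hn => h₁ n hn) (hκ.mono fun n hn => h₂ n hn)

theorem IsMildSolution.ae_isCompatible (husc : IsMildSolution P V f G κ usc)
    (hD : IsBoundedDomain D) (hV : IsCoefficient D V) (hf : IsCoefficient D f)
    (N : ℝ → S2 → Ω → ℂ) : ∀ᵐ ω ∂P, IsCompatible (activeData D V f N usc ω) V := by
  have hae : ∀ᵐ ω ∂P, ∀ m, Tendsto
      (fourierApproximation (activeData D V f N usc ω) (TopologicalSpace.denseSeq E3 m)) atTop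
      (𝓝 (fourierHat V (TopologicalSpace.denseSeq E3 m))) := ae_all_iff.2 fun m =>
    husc.ae_tendsto_activeData hD hV hf N
      ((exists_isDirectionChoice _).choose_spec.choose_spec.choose_spec.comp
        tendsto_natCast_atTop_atTop)
  filter_upwards [hae] with ω hω
  exact ⟨⟨D, hV⟩, hω⟩

end Data

end RandomSchrodinger

end

theorem theorem2 :
    -- one recovery map, which uses neither `σ` nor `f`
    ∃ recover : (S2 → ℝ → S2 → ℂ) → (E3 → ℝ),
      ∀ (D : Set E3) (_ : IsBoundedDomain D)
        (V f σ : E3 → ℝ) (_ : IsCoefficient D V) (_ : IsCoefficient D f) (_ : IsCoefficient D σ)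
        (Ω : Type*) (_ : MeasurableSpace Ω) (P : Measure Ω) (_ : IsProbabilityMeasure P)
        (W : Lp ℝ 2 (volume.restrict D) →ₗᵢ[ℝ] Lp ℝ 2 P) (_ : IsWhiteNoise W)
        (G : ℝ → E3 → Ω → ℂ) (_ : IsNoisePotential W σ G)
        (N : ℝ → S2 → Ω → ℂ) (_ : IsNoiseFarField W σ N)
        (κ : ℝ) (_ : 0 ≤ κ)
        (usc : ℝ → S2 → E3 → Ω → ℂ) (_ : IsMildSolution P V f G κ usc),
        -- almost every single realization of the data determines the potential
        (∀ᵐ ω ∂P, recover (activeData D V f N usc ω) =ᵐ[volume] V) ∧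
        -- the recovery formula: admissible directions exist for every frequency,
        (∀ p : E3, ∃ xhat d₁ d₂ : ℝ → S2, IsDirectionChoice atTop p id xhat d₁ d₂) ∧
        -- it holds almost surely along sequences of wave numbers,
        (∀ (p : E3) (k : ℕ → ℝ) (xhat d₁ d₂ : ℕ → S2),
          IsDirectionChoice atTop p k xhat d₁ d₂ →
          ∀ᵐ ω ∂P, Tendsto (fun n => (Real.sqrt (2 / Real.pi) : ℂ) *
              (activeData D V f N usc ω (xhat n) (k n) (d₁ n)
                - activeData D V f N usc ω (xhat n) (k n) (d₂ n)))
            atTop (𝓝 (fourierHat V p))) ∧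
        -- and as `k → ∞` for every sample that solves the system for all large `k`;
        (∀ ω : Ω,
          (∀ᶠ k in atTop, ∀ d : S2,
            IsScatteredWave V f (fun x => G k x ω) k d (fun x => usc k d x ω)) →
          ∀ (p : E3) (xhat d₁ d₂ : ℝ → S2), IsDirectionChoice atTop p id xhat d₁ d₂ →
            Tendsto (fun k => (Real.sqrt (2 / Real.pi) : ℂ) *
                (activeData D V f N usc ω (xhat k) k (d₁ k)
                  - activeData D V f N usc ω (xhat k) k (d₂ k)))
              atTop (𝓝 (fourierHat V p))) ∧
        -- the terms beyond the leading one are `O(1/k)`, uniformly in the sample and directions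
        (∃ C K : ℝ, ∀ (ω : Ω) (k : ℝ), K < k → ∀ xhat d₁ d₂ : S2,
          IsScatteredWave V f (fun x => G k x ω) k d₁ (fun x => usc k d₁ x ω) →
          IsScatteredWave V f (fun x => G k x ω) k d₂ (fun x => usc k d₂ x ω) →
          ‖activeData D V f N usc ω xhat k d₁ - activeData D V f N usc ω xhat k d₂
              - (Real.sqrt (Real.pi / 2) : ℂ) *
                (fourierHat V (k • ((xhat : E3) - (d₁ : E3)))
                  - fourierHat V (k • ((xhat : E3) - (d₂ : E3))))‖ ≤ C / k) := by
  refine ⟨recoverPotential, ?_⟩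
  intro D hD V f σ hV hf _ Ω _ P _ W _ G _ N _ κ _ usc husc
  refine ⟨?_, exists_isDirectionChoice, ?_, ?_, ?_⟩
  · filter_upwards [husc.ae_isCompatible hD hV hf N] with ω hω
    exact hω.recoverPotential_ae_eq
  · intro p k xhat d₁ d₂ h
    exact husc.ae_tendsto_activeData hD hV hf N h
  · intro ω hω p xhat d₁ d₂ h
    exact h.tendsto_farField hD hV hf (hω.mono fun k hk => hk (d₁ k)) (hω.mono fun k hk => hk (d₂ k))
  · obtain ⟨C, K, -, hmain⟩ := exists_norm_farField_sub_le hD hV hf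
    -- The sample enters only through `g` and `n`, over which the bound is uniform.
    exact ⟨C, K, fun ω k hk xhat d₁ d₂ h₁ h₂ =>
      hmain _ (N k xhat ω) k hk xhat d₁ d₂ _ _ h₁ h₂⟩
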